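/- Let $N\ge 1$, let $M(N)$ be the space of complex $N\times N$ matrices, and let $T:M(N)\to M(N)$ be a positive linear operator, i.e. $T(X)\succeq 0$ for all $X\succeq 0$. Call $T$ rank non-decreasing if $\operatorname{Rank}(T(X))\ge \operatorname{Rank}(X)$ for all $X\succeq 0$. Let $T^*$ be the dual of $T$ with respect to $\langle X,Y\rangle=\operatorname{tr}(XY^\dagger)$, put $$DS(T)=\operatorname{tr}\big((T(I)-I)^2\big)+\operatorname{tr}\big((T^*(I)-I)^2\big),$$ and call $T$ $\epsilon$-doubly stochastic if $DS(T)\le\epsilon^2$. For $C_1,C_2\in M(N)$ the operator scaling $S_{C_1,C_2}(T)$ is the positive operator $S_{C_1,C_2}(T)(X)=C_1\,T(C_2^\dagger X C_2)\,C_1^\dagger$. If $T(I)$ and $T^*(I)$ are both nonsingular, put $R(T)=S_{T(I)^{-1/2},\,I}(T)$ and $C(T)=S_{I,\,T^*(I)^{-1/2}}(T)$. The trajectory of Operator Sinkhorn Scaling is $T_0=T$, $T_{n+1}=R(T_n)$ for even $n$, $T_{n+1}=C(T_n)$ for odd $n$. Theorem 4.6. 1. If $T(I)$ and $T^*(I)$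 are nonsingular, then so are $T_n(I)$ and $T_n^*(I)$ for every $n\ge 0$ (so that the trajectory is defined), and $DS(T_n)\to 0$ as $n\to\infty$ if and only if $T$ is rank non-decreasing. If $T$ is rank non-decreasing, then $T(I)$ and $T^*(I)$ are nonsingular. 2. $T$ is rank non-decreasing if and only if for every $\epsilon>0$ there are $C_1,C_2\in M(N)$ such that $S_{C_1,C_2}(T)$ is $\epsilon$-doubly stochastic. 3. $T$ is rank non-decreasing if and only if there are $C_1,C_2\in M(N)$ such that $S_{C_1,C_2}(T)$ is $\frac1N$-doubly stochastic. -/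

import Mathlib

open Filter Topology
open scoped Matrix ComplexOrder MatrixOrder

namespace OpScaling

/-- The space `M(N)` of complex `N × N` matrices. -/
abbrev Mat (N : ℕ) : Type := Matrix (Fin N) (Fin N) ℂ

/-- Linear operators `M(N) → M(N)`. -/
abbrev Op (N : ℕ) : Type := Mat N →ₗ[ℂ] Mat N

variable {N : ℕ}

/-- `T` is positive: it maps positive semidefinite matrices to positive semidefinite matrices. -/
def IsPositive (T : Op N) : Prop :=
  ∀ X : Mat N, X.PosSemidef → (T X).PosSemidef

/-- `T` is rank non-decreasing: `Rank (T X) ≥ Rank X` for all `X ⪰ 0`. -/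
def RankNonDecreasing (T : Op N) : Prop :=
  ∀ X : Mat N, X.PosSemidef → X.rank ≤ (T X).rank

/-- The dual `T*` of `T` with respect to the inner product `⟨X, Y⟩ = tr (X Yᴴ)`. The entry
`(i, j)` of `T* Y` is `⟨Y, T (e_i e_jᴴ)⟩`; see `trace_mul_dual` for the defining identity. -/
def dual (T : Op N) : Op N where
  toFun Y := Matrix.of fun i j => (Y * (T (Matrix.single i j 1))ᴴ).trace
  map_add' Y Z := by
    ext i j
    simp [add_mul]
  map_smul' c Y := by
    ext i j
    simp

/-- The defining identity `⟨T X, Y⟩ = ⟨X, T* Y⟩` of the dual. -/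
theorem trace_mul_dual (T : Op N) (X Y : Mat N) :
    (T X * Yᴴ).trace = (X * (dual T Y)ᴴ).trace := by
  have key : ∀ i j : Fin N, (T (Matrix.single i j 1) * Yᴴ).trace
      = (Matrix.single i j (1 : ℂ) * (dual T Y)ᴴ).trace := by
    intro i j
    have h : (dual T Y)ᴴ j i = (T (Matrix.single i j 1) * Yᴴ).trace := by
      rw [Matrix.conjTranspose_apply]
      change star ((Y * (T (Matrix.single i j 1))ᴴ).trace) = _
      rw [← Matrix.trace_conjTranspose, Matrix.conjTranspose_mul,
        Matrix.conjTranspose_conjTranspose]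
    rw [← h, Matrix.trace_single_mul, one_smul]
  induction X using Matrix.induction_on' with
  | h_zero => simp
  | h_add p q hp hq => simp only [map_add, add_mul, Matrix.trace_add, hp, hq]
  | h_std_basis i j x =>
    have h : Matrix.single i j x = x • Matrix.single i j (1 : ℂ) := by simp
    rw [h, map_smul, Matrix.smul_mul, Matrix.smul_mul, Matrix.trace_smul, Matrix.trace_smul,
      key]

/-- The operator scaling `S_{C₁,C₂}(T)(X) = C₁ T(C₂ᴴ X C₂) C₁ᴴ`. -/
def scaling (C₁ C₂ : Mat N) (T : Op N) : Op N where
  toFun X := C₁ * T (C₂ᴴ * X * C₂) * C₁ᴴ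
  map_add' X Y := by simp [mul_add, add_mul]
  map_smul' c X := by simp

/-- `DS(T) = tr ((T(I) - I)²) + tr ((T*(I) - I)²)`. For positive `T` the matrices `T(I)` and
`T*(I)` are Hermitian, so both traces are real numbers. -/
def DS (T : Op N) : ℝ :=
  ((T 1 - 1) ^ 2).trace.re + ((dual T 1 - 1) ^ 2).trace.re

/-- `T` is `ε`-doubly stochastic: `DS(T) ≤ ε²`. -/
def IsEpsDoublyStochastic (ε : ℝ) (T : Op N) : Prop :=
  DS T ≤ ε ^ 2

/-- `A ^ (-1/2)`, the inverse of the positive square root (for positive definite `A`). -/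
noncomputable def invSqrt (A : Mat N) : Mat N := (CFC.sqrt A)⁻¹

/-- The analogue of row scaling, `R(T) = S_{T(I)^(-1/2), I}(T)`. -/
noncomputable def rowScaling (T : Op N) : Op N := scaling (invSqrt (T 1)) 1 T

/-- The analogue of column scaling, `C(T) = S_{I, T*(I)^(-1/2)}(T)`. -/
noncomputable def colScaling (T : Op N) : Op N := scaling 1 (invSqrt (dual T 1)) T

/-- Both `T(I)` and `T*(I)` are nonsingular: the condition under which `R(T)` and `C(T)` are
defined. -/
def Scalable (T : Op N) : Prop :=
  IsUnit (T 1) ∧ IsUnit (dual T 1)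

/-- The trajectory `T₀ = T, T₁ = R(T), T₂ = C(R(T)), T₃ = R(C(R(T))), …` of operator Sinkhorn's
iterative scaling. It is meaningful when all its members are `Scalable`. -/
noncomputable def sinkhorn (T : Op N) : ℕ → Op N
  | 0 => T
  | n + 1 => if Even n then rowScaling (sinkhorn T n) else colScaling (sinkhorn T n)

end OpScaling

/-! Two quantitative facts carry the theorem. Small defect forces the rank condition
(`rankNonDecreasing_of_DS_lt`). If `T` shrinks the rank of `X`, let `P` and `Q` be the support
projections of `X` and `T X`. Positivity keeps `T P` supported in `Q`, so tr(P T*(I)) ≤ tr(Q T(I))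
although P has larger rank than Q; hence the two marginals cannot both be close to the identity, and
`DS T ≥ 2/N`. The rank condition passes back through a scaling because the factor `C₂` must be
invertible. Conversely, a rank non-decreasing `T` has positive capacity: det T(X) ≥ c det X on
positive definite X (`RankNonDecreasing.exists_hasCapacityGE`). Each Sinkhorn step divides the
capacity bound by the determinant of the marginal being normalized. After the initial step one
marginal is the identity and the other has trace N, so these determinants are at most 1 by AM-GM,
while evaluating the capacity at X = I bounds their product below. Thus the sum of -log of the
determinants converges, its terms tend to 0, and they dominate `DS` (`trace_sub_one_sq_le`). All
members of the trajectory are scalings of `T`, so convergence yields ε-doubly stochastic scalings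
for every ε, and ε = 1/N closes the circle. -/

namespace OpScaling

variable {N : ℕ}

/-! ### Spectral tools and support projections. -/

section Matrices

/-- Unitary diagonalization of a Hermitian matrix, as an explicit product. -/
theorem exists_eq_mul_diagonal_mul {A : Mat N} (hA : A.IsHermitian) :
    ∃ U : Mat N, Uᴴ * U = 1 ∧ U * Uᴴ = 1 ∧
      A = U * Matrix.diagonal (fun i => (hA.eigenvalues i : ℂ)) * Uᴴ := by
  refine ⟨hA.eigenvectorUnitary, ?_, ?_, ?_⟩
  · exact Unitary.coe_star_mul_self hA.eigenvectorUnitary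
  · exact Unitary.coe_mul_star_self hA.eigenvectorUnitary
  · conv_lhs => rw [hA.spectral_theorem]
    rfl

/-- Over ℂ a real-valued quadratic form already forces the matrix to be Hermitian. -/
theorem posSemidef_of_dotProduct_nonneg {M : Mat N}
    (h : ∀ v : Fin N → ℂ, 0 ≤ star v ⬝ᵥ M *ᵥ v) : M.PosSemidef := by
  rw [← Matrix.isPositive_toEuclideanLin_iff, LinearMap.isPositive_iff_complex]
  intro x
  have hx : 0 ≤ inner ℂ (M.toEuclideanLin x) x := by
    have h1 := h x.ofLp
    rw [← inner_conj_symm, EuclideanSpace.inner_eq_star_dotProduct, dotProduct_comm]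
    exact star_nonneg_iff.mpr h1
  obtain ⟨h1, h2⟩ := RCLike.nonneg_iff.mp hx
  exact ⟨RCLike.ext (by simp) (by simpa using h2.symm), h1⟩

theorem trace_vecMulVec_mul (v w : Fin N → ℂ) (M : Mat N) :
    (Matrix.vecMulVec v w * M).trace = w ⬝ᵥ M *ᵥ v := by
  rw [Matrix.vecMulVec_mul, Matrix.trace_vecMulVec, Matrix.dotProduct_mulVec, dotProduct_comm]

theorem trace_mul_nonneg {A B : Mat N} (hA : A.PosSemidef) (hB : B.PosSemidef) :
    0 ≤ (A * B).trace := by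
  obtain ⟨y, rfl⟩ := CStarAlgebra.nonneg_iff_eq_star_mul_self.mp hB.nonneg
  rw [← mul_assoc, Matrix.trace_mul_comm, ← mul_assoc]
  exact (hA.mul_mul_conjTranspose_same y).trace_nonneg

/-- The orthogonal projection onto the range of a positive semidefinite matrix. -/
theorem exists_support_projection {X : Mat N} (hX : X.PosSemidef) :
    ∃ P : Mat N, P.PosSemidef ∧ (1 - P).PosSemidef ∧ P * P = P ∧ P.trace = (X.rank : ℂ) ∧
      X * P = X ∧ ∃ δ : ℝ, 0 < δ ∧ (X - (δ : ℂ) • P).PosSemidef := by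
  obtain ⟨U, hU, hU', hXU⟩ := exists_eq_mul_diagonal_mul hX.1
  set l := hX.1.eigenvalues with hl
  have hl0 : ∀ i, 0 ≤ l i := hX.eigenvalues_nonneg
  let e : Fin N → ℂ := fun i => if l i ≠ 0 then 1 else 0
  have key : ∀ f g : Fin N → ℂ, (U * Matrix.diagonal f * Uᴴ) * (U * Matrix.diagonal g * Uᴴ)
      = U * Matrix.diagonal (fun i => f i * g i) * Uᴴ := by
    intro f g
    rw [← Matrix.diagonal_mul_diagonal]
    calc _ = U * Matrix.diagonal f * (Uᴴ * U) * Matrix.diagonal g * Uᴴ := by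
          simp only [mul_assoc]
      _ = _ := by rw [hU, mul_one, mul_assoc U]
  have hpsd : ∀ f : Fin N → ℂ, (∀ i, 0 ≤ f i) → (U * Matrix.diagonal f * Uᴴ).PosSemidef :=
    fun f hf => (Matrix.PosSemidef.diagonal hf).mul_mul_conjTranspose_same U
  -- δ is the least nonzero eigenvalue, or 1 when X = 0.
  obtain ⟨δ, hδ, hδl⟩ : ∃ δ : ℝ, 0 < δ ∧ ∀ i, l i ≠ 0 → δ ≤ l i := by
    by_cases hne : (Finset.univ.filter fun i => l i ≠ 0).Nonempty
    · obtain ⟨i, hi, hmin⟩ := Finset.exists_min_image _ l hne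
      refine ⟨l i, lt_of_le_of_ne (hl0 i) (Ne.symm (Finset.mem_filter.mp hi).2), fun j hj => ?_⟩
      exact hmin j (by simpa using hj)
    · refine ⟨1, one_pos, fun i hi => (hne ⟨i, by simpa using hi⟩).elim⟩
  refine ⟨U * Matrix.diagonal e * Uᴴ, hpsd e ?_, ?_, ?_, ?_, ?_, δ, hδ, ?_⟩
  · intro i
    simp only [e]
    split_ifs <;> simp
  · have : (1 : Mat N) - U * Matrix.diagonal e * Uᴴ
        = U * Matrix.diagonal (fun i => 1 - e i) * Uᴴ := by
      rw [show (Matrix.diagonal (fun i => 1 - e i) : Mat N) = 1 - Matrix.diagonal e by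
        rw [← Matrix.diagonal_one, Matrix.diagonal_sub], mul_sub, sub_mul, mul_one, hU']
    rw [this]
    refine hpsd _ fun i => ?_
    simp only [e]
    split_ifs <;> simp
  · rw [key]
    congr 3
    funext i
    simp only [e]
    split_ifs <;> simp
  · rw [Matrix.trace_mul_comm, ← mul_assoc, hU, one_mul, Matrix.trace_diagonal,
      hX.1.rank_eq_card_non_zero_eigs, Fintype.card_subtype]
    simp only [e, Finset.sum_boole, hl]
  · conv_lhs => rw [hXU]
    conv_rhs => rw [hXU]
    rw [key]
    congr 3
    funext i
    simp only [e]
    split_ifs with h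
    · simp
    · simp [not_not.mp h]
  · have : X - (δ : ℂ) • (U * Matrix.diagonal e * Uᴴ)
        = U * Matrix.diagonal (fun i => (l i : ℂ) - δ * e i) * Uᴴ := by
      rw [show (Matrix.diagonal (fun i => (l i : ℂ) - δ * e i) : Mat N)
        = Matrix.diagonal (fun i => (l i : ℂ)) - (δ : ℂ) • Matrix.diagonal e by
          rw [← Matrix.diagonal_smul, Matrix.diagonal_sub]; rfl,
        mul_sub, sub_mul, ← hXU, Matrix.mul_smul, Matrix.smul_mul]
    rw [this]
    refine hpsd _ fun i => ?_
    simp only [e]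
    split_ifs with h
    · rw [mul_one, ← Complex.ofReal_sub]
      exact_mod_cast sub_nonneg.mpr (hδl i h)
    · simpa using hl0 i

theorem exists_smul_one_le {X : Mat N} (hX : X.PosDef) :
    ∃ δ : ℝ, 0 < δ ∧ (X - (δ : ℂ) • 1).PosSemidef := by
  obtain ⟨P, -, -, -, -, hXP, h⟩ := exists_support_projection hX.posSemidef
  have : P = 1 := hX.isUnit.mul_left_cancel (by rw [hXP, mul_one])
  rwa [this] at h

theorem isUnit_of_rank_eq {A : Mat N} (h : N ≤ A.rank) : IsUnit A := by
  rw [← Matrix.mulVec_surjective_iff_isUnit]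
  have h1 : LinearMap.range A.mulVecLin = ⊤ := by
    apply Submodule.eq_top_of_finrank_eq
    refine le_antisymm (Submodule.finrank_le _) ?_
    simpa [Matrix.rank] using h
  exact LinearMap.range_eq_top.mp h1

end Matrices

/-! ### Positivity, duality, scaling, and the rank criterion. -/

section Operators

theorem IsPositive.map_le {T : Op N} (hT : IsPositive T) {A B : Mat N}
    (h : (B - A).PosSemidef) : (T B - T A).PosSemidef := by
  rw [← map_sub]
  exact hT _ h

theorem IsPositive.dual {T : Op N} (hT : IsPositive T) : IsPositive (dual T) := by
  intro Y hY
  rw [← Matrix.posSemidef_conjTranspose_iff]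
  refine posSemidef_of_dotProduct_nonneg fun v => ?_
  rw [← trace_vecMulVec_mul, ← trace_mul_dual]
  exact trace_mul_nonneg (hT _ (Matrix.posSemidef_vecMulVec_self_star v)) hY.conjTranspose

theorem scaling_apply (C₁ C₂ X : Mat N) (T : Op N) :
    scaling C₁ C₂ T X = C₁ * T (C₂ᴴ * X * C₂) * C₁ᴴ := rfl

theorem dual_scaling_apply (C₁ C₂ Y : Mat N) (T : Op N) :
    dual (scaling C₁ C₂ T) Y = C₂ * dual T (C₁ᴴ * Y * C₁) * C₂ᴴ := by
  apply Matrix.conjTranspose_injective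
  rw [Matrix.ext_iff_trace_mul_left]
  intro X
  rw [← trace_mul_dual, scaling_apply]
  have h := trace_mul_dual T (C₂ᴴ * X * C₂) (C₁ᴴ * Y * C₁)
  simp only [Matrix.conjTranspose_mul, Matrix.conjTranspose_conjTranspose, mul_assoc] at h ⊢
  rw [Matrix.trace_mul_comm C₁]
  simp only [mul_assoc]
  rw [h, Matrix.trace_mul_comm]
  simp only [mul_assoc]

theorem scaling_scaling (A₁ A₂ C₁ C₂ : Mat N) (T : Op N) :
    scaling A₁ A₂ (scaling C₁ C₂ T) = scaling (A₁ * C₁) (A₂ * C₂) T := by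
  ext1 X
  simp only [scaling_apply, Matrix.conjTranspose_mul, mul_assoc]

theorem IsPositive.scaling {T : Op N} (hT : IsPositive T) (C₁ C₂ : Mat N) :
    IsPositive (scaling C₁ C₂ T) := fun _ hX =>
  (hT _ (hX.conjTranspose_mul_mul_same C₂)).mul_mul_conjTranspose_same C₁

/-- X ⪰ δI gives T(X) ⪰ δT(I) ≻ 0. -/
theorem IsPositive.map_posDef {T : Op N} (hT : IsPositive T) (hu : IsUnit (T 1)) {X : Mat N}
    (hX : X.PosDef) : (T X).PosDef := by
  obtain ⟨δ, hδ, h⟩ := exists_smul_one_le hX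
  have h1 : (T 1).PosDef := (hT 1 Matrix.PosSemidef.one).posDef_iff_isUnit.mpr hu
  have h2 := hT.map_le h
  rw [map_smul] at h2
  have h3 : ((δ : ℂ) • T 1).PosDef := h1.smul (by exact_mod_cast hδ)
  simpa using h3.add_posSemidef h2

theorem Scalable.scaling {T : Op N} (hT : IsPositive T) (h : Scalable T) {C₁ C₂ : Mat N}
    (h₁ : IsUnit C₁) (h₂ : IsUnit C₂) : Scalable (scaling C₁ C₂ T) := by
  have hpd : ∀ {C : Mat N}, IsUnit C → (Cᴴ * 1 * C).PosDef := fun {C} hC => by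
    rw [mul_one]
    exact Matrix.PosDef.conjTranspose_mul_self C (Matrix.mulVec_injective_iff_isUnit.mpr hC)
  constructor
  · rw [scaling_apply]
    exact (h₁.mul (hT.map_posDef h.1 (hpd h₂)).isUnit).mul h₁.star
  · rw [dual_scaling_apply]
    exact (h₂.mul (hT.dual.map_posDef h.2 (hpd h₁)).isUnit).mul h₂.star

theorem trace_mul_dual_one (T : Op N) (hT : IsPositive T) (X : Mat N) :
    (X * dual T 1).trace = (T X).trace := by
  have h := trace_mul_dual T X 1
  rw [(hT.dual 1 Matrix.PosSemidef.one).1.eq] at h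
  simpa using h.symm

theorem RankNonDecreasing.scalable {T : Op N} (hT : IsPositive T) (h : RankNonDecreasing T) :
    Scalable T := by
  constructor
  · apply isUnit_of_rank_eq
    simpa using h 1 Matrix.PosSemidef.one
  · rw [← Matrix.mulVec_injective_iff_isUnit, ← Matrix.coe_mulVecLin, injective_iff_map_eq_zero]
    intro v hv
    have hX := Matrix.posSemidef_vecMulVec_self_star v
    -- For v in the kernel of T*(I), tr T(vv*) = ⟨v, T*(I)v⟩ = 0, so T would kill a rank-one matrix
    -- unless v = 0.
    have h0 : T (Matrix.vecMulVec v (star v)) = 0 := by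
      rw [← (hT _ hX).trace_eq_zero_iff, ← trace_mul_dual_one T hT, trace_vecMulVec_mul]
      rw [Matrix.mulVecLin_apply] at hv
      rw [hv, dotProduct_zero]
    have hr := h _ hX
    rw [h0, Matrix.rank_zero, Nat.le_zero] at hr
    have hz : Matrix.vecMulVec v (star v) = 0 := by
      obtain ⟨P, hP, -, -, hPt, hXP, -⟩ := exists_support_projection hX
      rw [hr, Nat.cast_zero, hP.trace_eq_zero_iff] at hPt
      rw [← hXP, hPt, mul_zero]
    have ht := congrArg Matrix.trace hz
    rw [Matrix.trace_vecMulVec, Matrix.trace_zero] at ht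
    rwa [dotProduct_comm, dotProduct_star_self_eq_zero] at ht

/-- Nonsingularity of the scaled dual at I makes C₂ invertible, so the inner congruence can be
undone; multiplying by C₁ on the outside can only lower the rank. -/
theorem rankNonDecreasing_of_scaling {T : Op N} {C₁ C₂ : Mat N}
    (h : RankNonDecreasing (scaling C₁ C₂ T)) (hS : Scalable (scaling C₁ C₂ T)) :
    RankNonDecreasing T := by
  have h2 : IsUnit C₂ := by
    have hu := hS.2
    rw [dual_scaling_apply, mul_assoc] at hu
    rw [Matrix.isUnit_iff_isUnit_det] at hu ⊢
    rw [Matrix.det_mul] at hu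
    exact isUnit_of_mul_isUnit_left hu
  have hd : IsUnit C₂.det := (Matrix.isUnit_iff_isUnit_det _).mp h2
  intro X hX
  have hC : C₂⁻¹ * C₂ = 1 := Matrix.nonsing_inv_mul _ hd
  have hC' : C₂ᴴ * (C₂⁻¹)ᴴ = 1 := by rw [← Matrix.conjTranspose_mul, hC, Matrix.conjTranspose_one]
  set X' := (C₂⁻¹)ᴴ * X * C₂⁻¹ with hX'
  have hXX : C₂ᴴ * X' * C₂ = X := by
    calc C₂ᴴ * X' * C₂ = (C₂ᴴ * (C₂⁻¹)ᴴ) * X * (C₂⁻¹ * C₂) := by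
          rw [hX']; simp only [mul_assoc]
      _ = X := by rw [hC, hC', one_mul, mul_one]
  have h1 := h X' (hX.conjTranspose_mul_mul_same _)
  rw [scaling_apply, hXX] at h1
  calc X.rank = (C₂ᴴ * X' * C₂).rank := by rw [hXX]
    _ ≤ X'.rank := (Matrix.rank_mul_le_left _ _).trans (Matrix.rank_mul_le_right _ _)
    _ ≤ _ := h1
    _ ≤ (T X).rank := (Matrix.rank_mul_le_left _ _).trans (Matrix.rank_mul_le_right _ _)

/-- A positive operator that is close enough to being doubly stochastic does not decrease the
rank. -/
theorem rankNonDecreasing_of_DS_lt {T : Op N} (hT : IsPositive T) (hDS : DS T < 2 / N) :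
    RankNonDecreasing T := by
  rcases Nat.eq_zero_or_pos N with rfl | hN
  · intro X _
    simp [Matrix.rank_le_card_width X |>.trans_eq (by simp) |> Nat.le_zero.mp]
  intro X hX
  by_contra! hlt
  obtain ⟨P, hP, hP1, hPP, hPt, -, δ, hδ, hXP⟩ := exists_support_projection hX
  obtain ⟨Q, hQ, hQ1, hQQ, hQt, hTQ, -⟩ := exists_support_projection (hT X hX)
  have hA := hT.dual 1 Matrix.PosSemidef.one
  have hB := hT 1 Matrix.PosSemidef.one
  set A := dual T 1 with hAdef
  set B := T 1 with hBdef
  -- From X ⪰ δP: δ tr(T(P)(1-Q)) ≤ tr(T(X)(1-Q)) = 0.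
  have hTP : (T P * (1 - Q)).trace ≤ 0 := by
    have h1 := trace_mul_nonneg (hT _ hXP) hQ1
    rw [map_sub, map_smul, sub_mul, mul_sub (T X), mul_one, hTQ, sub_self, zero_sub,
      Matrix.trace_neg, Matrix.smul_mul, Matrix.trace_smul, Left.nonneg_neg_iff, smul_eq_mul] at h1
    have hδ' : (0 : ℂ) < δ := by exact_mod_cast hδ
    by_contra hcon
    have h0 := trace_mul_nonneg (hT _ hP) hQ1
    exact absurd (lt_of_lt_of_le (mul_pos hδ' (lt_of_le_of_ne h0 fun h => hcon h.symm.le)) h1)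
      (lt_irrefl _)
  have h2 : 0 ≤ (T (1 - P) * Q).trace := trace_mul_nonneg (hT _ hP1) hQ
  have htr : (P * A).trace = (T P).trace := trace_mul_dual_one T hT P
  have htr1 : A.trace = B.trace := by
    simpa using trace_mul_dual_one T hT 1
  have hmain : (P * A).trace ≤ (B * Q).trace := by
    rw [map_sub, sub_mul, Matrix.trace_sub, sub_nonneg] at h2
    rw [mul_sub, mul_one, Matrix.trace_sub, sub_nonpos] at hTP
    rw [htr]
    exact hTP.trans h2
  have hmain' : (P * A).trace.re ≤ (B * Q).trace.re := (Complex.le_def.mp hmain).1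
  have sq_nonneg' : ∀ M : Mat N, M.IsHermitian → 0 ≤ (M * M).trace.re := fun M hM => by
    have := (Matrix.posSemidef_conjTranspose_mul_self M).trace_nonneg
    rw [hM.eq] at this
    exact (Complex.le_def.mp this).1
  -- Expansion of the squared distance from M - 1 to a multiple of the reflection 2E - 1, whose
  -- square is 1 and contributes t²N.
  have htrans : ∀ (M E : Mat N) (t : ℝ), E * E = E →
      ((M - 1 - (t : ℂ) • (2 • E - 1)) * (M - 1 - (t : ℂ) • (2 • E - 1))).trace.re
        = ((M - 1) ^ 2).trace.re - 4 * t * (M * E).trace.re + 4 * t * E.trace.re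
          + 2 * t * M.trace.re - 2 * t * N + t ^ 2 * N := by
    intro M E t hE
    have e1 : (M - 1 - (t : ℂ) • (2 • E - 1)) * (M - 1 - (t : ℂ) • (2 • E - 1))
        = (M - 1) ^ 2 - (2 * t : ℂ) • (M * E) - (2 * t : ℂ) • (E * M) + (4 * t : ℂ) • E
          + (2 * t : ℂ) • M - (2 * t : ℂ) • 1 + (t ^ 2 : ℂ) • (4 • (E * E - E) + 1) := by
      simp only [sub_mul, mul_sub, Matrix.smul_mul, Matrix.mul_smul, pow_two, smul_sub,
        smul_add, mul_one, one_mul]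
      module
    rw [e1, hE]
    simp only [Matrix.trace_sub, Matrix.trace_add, Matrix.trace_smul, Matrix.trace_mul_comm E M,
      sub_self, smul_zero, zero_add, Matrix.trace_one, Fintype.card_fin, smul_eq_mul]
    norm_cast
    simp only [Complex.add_re, Complex.sub_re, Complex.re_ofReal_mul]
    norm_cast
    ring
  -- Adding the two inequalities below gives DS ≥ 4t - 2Nt², which is largest at t = 1/N.
  set t : ℝ := 1 / N with ht
  have hherm : ∀ (M E : Mat N) (s : ℝ), M.IsHermitian → E.IsHermitian →
      (M - 1 - (s : ℂ) • (2 • E - 1)).IsHermitian := by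
    intro M E s hM hE
    simp [Matrix.IsHermitian, hM.eq, hE.eq, two_mul]
  -- Opposite signs of t for the two marginals cancel the terms in tr A = tr B, leaving the gaps
  -- tr(BQ) - tr(PA) ≥ 0 and rank P - rank Q ≥ 1.
  have i1 := sq_nonneg' _ (hherm B Q t hB.1 hQ.1)
  have i2 := sq_nonneg' _ (hherm A P (-t) hA.1 hP.1)
  rw [htrans B Q t hQQ, hQt] at i1
  rw [htrans A P (-t) hPP, hPt, Matrix.trace_mul_comm] at i2
  have htr1' : A.trace.re = B.trace.re := by rw [htr1]
  have hrank : ((T X).rank : ℝ) + 1 ≤ X.rank := by exact_mod_cast hlt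
  have hN' : (0 : ℝ) < N := by exact_mod_cast hN
  have htN : t * N = 1 := by rw [ht]; field_simp
  have htpos : 0 < t := by positivity
  rw [DS, ← hAdef, ← hBdef] at hDS
  have h2N : (2 : ℝ) / N = 2 * t := by rw [ht]; ring
  rw [h2N] at hDS
  simp only [Complex.natCast_re] at i1 i2
  have e3 := mul_le_mul_of_nonneg_left hmain' htpos.le
  have e4 := mul_le_mul_of_nonneg_left hrank htpos.le
  have e5 : t ^ 2 * N = t := by rw [pow_two, mul_assoc, htN, mul_one]
  rw [neg_sq] at i2
  rw [htr1'] at i2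
  nlinarith

end Operators

/-! ### Inverse square roots. -/

section InvSqrt

theorem invSqrt_isHermitian {A : Mat N} : (invSqrt A).IsHermitian :=
  Matrix.IsHermitian.inv (Matrix.nonneg_iff_posSemidef.mp (CFC.sqrt_nonneg A)).1

theorem invSqrt_mul_mul_invSqrt {A : Mat N} (hA : A.PosDef) :
    invSqrt A * A * invSqrt A = 1 ∧ IsUnit (invSqrt A) := by
  have h := CFC.sqrt_mul_sqrt_self A hA.posSemidef.nonneg
  have hu : IsUnit (CFC.sqrt A) := by
    have hu := hA.isUnit
    rw [← h, Matrix.isUnit_iff_isUnit_det, Matrix.det_mul] at hu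
    exact (Matrix.isUnit_iff_isUnit_det _).mpr (isUnit_of_mul_isUnit_left hu)
  have hd := (Matrix.isUnit_iff_isUnit_det _).mp hu
  constructor
  · rw [invSqrt]
    conv_lhs => enter [1, 2]; rw [← h]
    rw [← mul_assoc, Matrix.nonsing_inv_mul _ hd, one_mul, Matrix.mul_nonsing_inv _ hd]
  · rw [invSqrt, Matrix.isUnit_nonsing_inv_iff]
    exact hu

theorem det_invSqrt {A : Mat N} (hA : A.PosDef) :
    (invSqrt A).det * (invSqrt A).det = (A.det)⁻¹ := by
  have h := congrArg Matrix.det (invSqrt_mul_mul_invSqrt hA).1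
  rw [Matrix.det_mul, Matrix.det_mul, Matrix.det_one] at h
  exact eq_inv_of_mul_eq_one_left (by rw [← h]; ring)

end InvSqrt

/-! ### Determinant monotonicity and lower bounds from selected columns. -/

section Determinants

theorem one_le_det {A : Mat N} (hA : (A - 1).PosSemidef) : 1 ≤ A.det := by
  obtain ⟨U, hU, hU', hAU⟩ := exists_eq_mul_diagonal_mul hA.1
  have hl := hA.eigenvalues_nonneg
  generalize hA.1.eigenvalues = l at hAU hl
  have h : A = U * Matrix.diagonal (fun i => 1 + (l i : ℂ)) * Uᴴ := by
    rw [show (Matrix.diagonal (fun i => 1 + (l i : ℂ)) : Mat N)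
      = 1 + Matrix.diagonal (fun i => (l i : ℂ)) by
        rw [← Matrix.diagonal_one, Matrix.diagonal_add], mul_add, add_mul, ← hAU, mul_one, hU']
    abel
  have hdet : A.det = ∏ i, (1 + (l i : ℂ)) := by
    conv_lhs => rw [h]
    rw [Matrix.det_mul_comm, ← mul_assoc, hU, one_mul, Matrix.det_diagonal]
  rw [hdet]
  have : (1 : ℝ) ≤ ∏ i, (1 + l i) :=
    Finset.one_le_prod fun i _ => le_add_of_nonneg_right (hl i)
  exact_mod_cast this

/-- The determinant is monotone on positive semidefinite matrices. -/
theorem det_le_det {A B : Mat N} (hA : A.PosSemidef) (h : (B - A).PosSemidef) :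
    A.det ≤ B.det := by
  by_cases h0 : A.det = 0
  · rw [h0]
    simpa using (hA.add h).det_nonneg
  have hpd : A.PosDef := hA.posDef_iff_det_ne_zero.mpr h0
  obtain ⟨hS, -⟩ := invSqrt_mul_mul_invSqrt hpd
  -- Congruence by A^(-1/2) reduces to the case A = I.
  have h1 := h.mul_mul_conjTranspose_same (invSqrt A)
  rw [invSqrt_isHermitian.eq, mul_sub, sub_mul, hS] at h1
  have h2 := one_le_det h1
  rw [Matrix.det_mul, Matrix.det_mul, mul_right_comm, det_invSqrt hpd] at h2
  have h3 := mul_le_mul_of_nonneg_left h2 hA.det_nonneg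
  rwa [mul_one, mul_inv_cancel_left₀ h0] at h3

theorem trace_smul_one_sub_posSemidef {B : Mat N} (hB : B.PosSemidef) :
    (B.trace • (1 : Mat N) - B).PosSemidef := by
  obtain ⟨U, hU, hU', hBU⟩ := exists_eq_mul_diagonal_mul hB.1
  have h : B.trace • (1 : Mat N) - B
      = U * Matrix.diagonal (fun i => B.trace - (hB.1.eigenvalues i : ℂ)) * Uᴴ := by
    rw [show (Matrix.diagonal (fun i => B.trace - (hB.1.eigenvalues i : ℂ)) : Mat N)
      = B.trace • (1 : Mat N) - Matrix.diagonal (fun i => (hB.1.eigenvalues i : ℂ)) by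
        rw [← Matrix.diagonal_one, ← Matrix.diagonal_smul, Matrix.diagonal_sub]
        simp, mul_sub, sub_mul, ← hBU]
    simp [hU']
  rw [h]
  refine Matrix.PosSemidef.mul_mul_conjTranspose_same (Matrix.PosSemidef.diagonal fun i => ?_) U
  rw [hB.1.trace_eq_sum_eigenvalues, Pi.zero_apply, sub_nonneg]
  have : hB.1.eigenvalues i ≤ ∑ j, hB.1.eigenvalues j :=
    Finset.single_le_sum (fun j _ => hB.eigenvalues_nonneg j) (Finset.mem_univ i)
  have h2 : (hB.1.eigenvalues i : ℂ) ≤ ((∑ j, hB.1.eigenvalues j : ℝ) : ℂ) := by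
    exact_mod_cast this
  simpa using h2

/-- tr(B) B ⪰ B² because B ⪯ tr(B) I, and B² = BB* dominates the contribution B e_j e_j* B* of a
single column. -/
theorem trace_smul_sub_vecMulVec_col_posSemidef {B : Mat N} (hB : B.PosSemidef) (j : Fin N) :
    (B.trace • B - Matrix.vecMulVec (B.col j) (star (B.col j))).PosSemidef := by
  have h1 : (B.trace • B - B * B).PosSemidef := by
    obtain ⟨y, hy⟩ := CStarAlgebra.nonneg_iff_eq_star_mul_self.mp hB.nonneg
    have h := (trace_smul_one_sub_posSemidef
      (Matrix.posSemidef_self_mul_conjTranspose y)).conjTranspose_mul_mul_same y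
    rw [mul_sub, sub_mul, Matrix.mul_smul, mul_one, Matrix.smul_mul,
      Matrix.trace_mul_comm] at h
    rw [hy]
    simpa only [mul_assoc, Matrix.star_eq_conjTranspose] using h
  have h2 : (B * B - Matrix.vecMulVec (B.col j) (star (B.col j))).PosSemidef := by
    have h3 : (1 - Matrix.diagonal (Pi.single j (1 : ℂ)) : Mat N).PosSemidef := by
      rw [← Matrix.diagonal_one, Matrix.diagonal_sub]
      refine Matrix.PosSemidef.diagonal fun i => ?_
      by_cases h : i = j
      · subst h; simp
      · simp [h]
    have h4 := h3.mul_mul_conjTranspose_same B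
    rw [mul_sub, sub_mul, mul_one] at h4
    have h5 : B * Matrix.diagonal (Pi.single j (1 : ℂ)) * Bᴴ
        = Matrix.vecMulVec (B.col j) (star (B.col j)) := by
      ext a b
      rw [Matrix.mul_apply]
      simp [Matrix.mul_diagonal, Matrix.vecMulVec_apply, Pi.single_apply]
    rw [h5] at h4
    rwa [show B * Bᴴ = B * B by rw [hB.1.eq]] at h4
  simpa using h1.add h2

/-- If `Y ⪰ l k • B k` for every `k`, then `det Y` is bounded below through the determinant of
any matrix whose `k`-th column is a column of `B k`. -/
theorem prod_mul_normSq_det_le {Y : Mat N} {B : Fin N → Mat N}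
    {l : Fin N → ℝ} {m : ℝ} (hm : 0 ≤ m) (hl : ∀ k, 0 ≤ l k) (hB : ∀ k, (B k).PosSemidef)
    (hBm : ∀ k, (B k).trace ≤ m) (hYB : ∀ k, (Y - (l k : ℂ) • B k).PosSemidef)
    (σ : Fin N → Fin N) :
    (∏ k, l k) * Complex.normSq (Matrix.of fun i k => B k i (σ k)).det
      ≤ (N * m) ^ N * Y.det.re := by
  set V : Mat N := Matrix.of fun i k => B k i (σ k) with hV
  have hsum : V * Matrix.diagonal (fun k => (l k : ℂ)) * Vᴴ
      = ∑ k, (l k : ℂ) • Matrix.vecMulVec ((B k).col (σ k)) (star ((B k).col (σ k))) := by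
    ext a b
    rw [Matrix.mul_apply, Matrix.sum_apply]
    refine Finset.sum_congr rfl fun k _ => ?_
    simp [Matrix.mul_diagonal, Matrix.vecMulVec_apply, hV]
    ring
  -- With b the chosen column of B = B k and l = l k, the difference is m(Y - lB) + l(tr(B)B - bb*)
  -- + l(m - tr B)B. Summing over k gives NmY ⪰ V diag(l) V*, and determinants are compared.
  have hterm : ∀ k, ((m : ℂ) • Y - (l k : ℂ) •
      Matrix.vecMulVec ((B k).col (σ k)) (star ((B k).col (σ k)))).PosSemidef := by
    intro k
    have h1 := (hYB k).smul (a := (m : ℂ)) (by exact_mod_cast hm)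
    have hlk : (0 : ℂ) ≤ l k := by exact_mod_cast hl k
    have h2 := (trace_smul_sub_vecMulVec_col_posSemidef (hB k) (σ k)).smul hlk
    have h3 := (hB k).smul (a := (l k : ℂ) * (m - (B k).trace))
      (mul_nonneg hlk (sub_nonneg.mpr (hBm k)))
    have h4 := (h1.add h2).add h3
    convert h4 using 1
    module
  have hdiff : (((N * m : ℝ) : ℂ) • Y - V * Matrix.diagonal (fun k => (l k : ℂ)) * Vᴴ).PosSemidef := by
    have h := Matrix.posSemidef_sum Finset.univ fun k _ => hterm k
    rw [Finset.sum_sub_distrib, ← hsum, Finset.sum_const, Finset.card_univ, Fintype.card_fin] at h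
    convert h using 2
    rw [← Nat.cast_smul_eq_nsmul ℂ, smul_smul]
    push_cast
    rfl
  have hpsd : (V * Matrix.diagonal (fun k => (l k : ℂ)) * Vᴴ).PosSemidef :=
    (Matrix.PosSemidef.diagonal fun k => by simpa using hl k).mul_mul_conjTranspose_same V
  have hdet := det_le_det hpsd hdiff
  rw [Matrix.det_smul, Matrix.det_mul, Matrix.det_mul, Matrix.det_diagonal, Fintype.card_fin,
    Matrix.det_conjTranspose, mul_right_comm] at hdet
  have h := (Complex.le_def.mp hdet).1
  rw [show V.det * star V.det = (Complex.normSq V.det : ℂ) from Complex.mul_conj _,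
    ← Complex.ofReal_prod, ← Complex.ofReal_mul, Complex.ofReal_re, ← Complex.ofReal_pow,
    Complex.re_ofReal_mul] at h
  linarith

/-- A choice of one column from each of the matrices `B k`, where the ranks of these grow, such
that the chosen columns are independent. -/
theorem exists_columns_det_ne_zero {B : Fin N → Mat N} (h : ∀ k : Fin N, (k : ℕ) + 1 ≤ (B k).rank) :
    ∃ σ : Fin N → Fin N, (Matrix.of fun i k => B k i (σ k) : Mat N).det ≠ 0 := by
  have key : ∀ m (hm : m ≤ N), ∃ σ : Fin m → Fin N,
      LinearIndependent ℂ fun k : Fin m => (B (Fin.castLE hm k)).col (σ k) := by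
    intro m
    induction m with
    | zero => exact fun _ => ⟨Fin.elim0, linearIndependent_empty_type⟩
    | succ m ih =>
      intro hm
      obtain ⟨σ, hσ⟩ := ih (Nat.le_of_succ_le hm)
      set v := fun k : Fin m => (B (Fin.castLE (Nat.le_of_succ_le hm) k)).col (σ k) with hv
      -- Greedy choice: m vectors cannot span the column space of B m, which has dimension at least
      -- m + 1.
      obtain ⟨j, hj⟩ : ∃ j, (B ⟨m, hm⟩).col j ∉ Submodule.span ℂ (Set.range v) := by
        by_contra! hcon
        have h1 : Submodule.span ℂ (Set.range (B ⟨m, hm⟩).col)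
            ≤ Submodule.span ℂ (Set.range v) :=
          Submodule.span_le.mpr (by rintro _ ⟨j, rfl⟩; exact hcon j)
        have h2 := Submodule.finrank_mono h1
        rw [← Matrix.rank_eq_finrank_span_cols] at h2
        have h3 := finrank_range_le_card (R := ℂ) v
        rw [Fintype.card_fin] at h3
        have h4 := h ⟨m, hm⟩
        simp only [Set.finrank] at h3
        simp only at h4
        omega
      refine ⟨Fin.snoc σ j, ?_⟩
      have h5 := linearIndependent_finSnoc.mpr ⟨hσ, hj⟩
      suffices hs : (fun k : Fin (m + 1) => (B (Fin.castLE hm k)).col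
          ((Fin.snoc σ j : Fin (m + 1) → Fin N) k)) = Fin.snoc v ((B ⟨m, hm⟩).col j) by
        rw [hs]
        exact h5
      funext k
      refine Fin.lastCases ?_ (fun k => ?_) k
      · simp only [Fin.snoc_last]
        rfl
      · simp only [Fin.snoc_castSucc, hv]
        rfl
  obtain ⟨σ, hσ⟩ := key N le_rfl
  refine ⟨σ, ?_⟩
  rw [← isUnit_iff_ne_zero, ← Matrix.isUnit_iff_isUnit_det,
    ← Matrix.linearIndependent_cols_iff_isUnit]
  exact hσ

end Determinants

/-! ### Positive capacity from the rank condition, by compactness. -/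

section Capacity

/-- The orthogonal projection onto the span of the columns `0, …, k` of a unitary matrix. -/
def flagProj (U : Mat N) (k : Fin N) : Mat N :=
  U * Matrix.diagonal (fun i => if i ≤ k then 1 else 0) * Uᴴ

theorem flagProj_posSemidef (U : Mat N) (k : Fin N) : (flagProj U k).PosSemidef :=
  Matrix.PosSemidef.mul_mul_conjTranspose_same
    (Matrix.PosSemidef.diagonal fun i => by by_cases h : i ≤ k <;> simp [h]) U

theorem one_sub_flagProj_posSemidef {U : Mat N} (hU : U * Uᴴ = 1) (k : Fin N) :
    (1 - flagProj U k).PosSemidef := by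
  have h : 1 - flagProj U k
      = U * (1 - Matrix.diagonal (fun i => if i ≤ k then 1 else 0)) * Uᴴ := by
    rw [mul_sub, sub_mul, mul_one, hU, flagProj]
  rw [h, ← Matrix.diagonal_one, Matrix.diagonal_sub]
  exact Matrix.PosSemidef.mul_mul_conjTranspose_same
    (Matrix.PosSemidef.diagonal fun i => by by_cases h : i ≤ k <;> simp [h]) U

theorem rank_flagProj {U : Mat N} (hU : U * Uᴴ = 1) (k : Fin N) :
    (flagProj U k).rank = k + 1 := by
  have hdet : U.det * Uᴴ.det = 1 := by rw [← Matrix.det_mul, hU, Matrix.det_one]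
  rw [flagProj, Matrix.rank_mul_eq_left_of_isUnit_det _ _ (IsUnit.of_mul_eq_one_right _ hdet),
    Matrix.rank_mul_eq_right_of_isUnit_det _ _ (IsUnit.of_mul_eq_one _ hdet),
    Matrix.rank_diagonal, Fintype.card_subtype]
  rw [show (Finset.univ.filter fun i : Fin N => (if i ≤ k then (1 : ℂ) else 0) ≠ 0)
    = Finset.Iic k by ext i; simp, Fin.card_Iic]

theorem isCompact_unitary : IsCompact {U : Mat N | U * Uᴴ = 1} := by
  have hbox : IsCompact (Set.univ.pi fun _ : Fin N => Set.univ.pi fun _ : Fin N =>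
      Metric.closedBall (0 : ℂ) 1) :=
    isCompact_univ_pi fun _ => isCompact_univ_pi fun _ => isCompact_closedBall _ _
  refine IsCompact.of_isClosed_subset (s := (Set.univ.pi fun _ : Fin N => Set.univ.pi
    fun _ : Fin N => Metric.closedBall (0 : ℂ) 1 : Set (Mat N))) hbox ?_ ?_
  · exact isClosed_eq (by fun_prop) continuous_const
  · intro U hU i _ j _
    rw [mem_closedBall_zero_iff]
    exact entry_norm_bound_of_unitary (Matrix.mem_unitaryGroup_iff.mpr hU) i j

/-- A positive definite matrix has a unitary diagonalization with decreasing eigenvalues. -/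
theorem exists_antitone_diagonalization {X : Mat N} (hX : X.PosDef) :
    ∃ (U : Mat N) (l : Fin N → ℝ), U * Uᴴ = 1 ∧ Antitone l ∧ (∀ i, 0 < l i) ∧
      X = U * Matrix.diagonal (fun i => (l i : ℂ)) * Uᴴ := by
  obtain ⟨U, -, hU', hXU⟩ := exists_eq_mul_diagonal_mul hX.1
  set e := hX.1.eigenvalues
  let π := Tuple.sort fun i => -e i
  refine ⟨U.submatrix id π, e ∘ π, ?_, ?_, fun i => hX.eigenvalues_pos _, ?_⟩
  · rw [Matrix.conjTranspose_submatrix, Matrix.submatrix_mul_equiv, hU', Matrix.submatrix_id_id]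
  · intro i j hij
    have := Tuple.monotone_sort (fun i => -e i) hij
    simpa [π] using this
  · have h : Matrix.diagonal (fun i => ((e ∘ π) i : ℂ))
        = (Matrix.diagonal fun i => (e i : ℂ)).submatrix π π := by
      rw [Matrix.submatrix_diagonal_equiv]; rfl
    rw [h, Matrix.conjTranspose_submatrix, Matrix.submatrix_mul_equiv, Matrix.submatrix_mul_equiv,
      Matrix.submatrix_id_id, ← hXU]

/-- `T` has capacity at least `c`: `det (T X) ≥ c det X` for all `X ≻ 0`. -/
def HasCapacityGE (c : ℝ) (T : Op N) : Prop :=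
  ∀ X : Mat N, X.PosDef → c * X.det.re ≤ (T X).det.re

/-- A rank non-decreasing positive operator has positive capacity. -/
theorem RankNonDecreasing.exists_hasCapacityGE {T : Op N} (hT : IsPositive T)
    (h : RankNonDecreasing T) : ∃ c : ℝ, 0 < c ∧ HasCapacityGE c T := by
  let V : (Fin N → Fin N) → Mat N → Mat N :=
    fun σ U => Matrix.of fun i k => T (flagProj U k) i (σ k)
  -- The independent choice of columns depends on U; summing over all choices σ gives one continuous
  -- function, positive on the compact unitary group.
  let F : Mat N → ℝ := fun U => ∑ σ, Complex.normSq (V σ U).det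
  have hTc : Continuous T := LinearMap.continuous_of_finiteDimensional T
  have hF : Continuous F := by
    refine continuous_finsetSum _ fun σ _ => Complex.continuous_normSq.comp ?_
    refine Continuous.matrix_det (continuous_matrix fun i k => ?_)
    have h1 : Continuous fun U : Mat N => flagProj U k := by
      unfold flagProj
      fun_prop
    exact (hTc.comp h1).matrix_elem i (σ k)
  obtain ⟨U₀, hU₀, hmin⟩ := isCompact_unitary.exists_isMinOn ⟨1, by simp⟩ hF.continuousOn
  have hpos : 0 < F U₀ := by
    obtain ⟨σ, hσ⟩ := exists_columns_det_ne_zero (B := fun k => T (flagProj U₀ k)) fun k => by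
      rw [← rank_flagProj hU₀ k]
      exact h _ (flagProj_posSemidef U₀ k)
    exact Finset.sum_pos' (fun σ _ => Complex.normSq_nonneg _)
      ⟨σ, Finset.mem_univ _, Complex.normSq_pos.mpr hσ⟩
  -- A bound for the trace of every T(`flagProj U k`); the extra 1 keeps it positive.
  set m : ℝ := (T 1).trace.re + 1 with hm
  have hT1 : 0 ≤ (T 1).trace := (hT 1 Matrix.PosSemidef.one).trace_nonneg
  have hmpos : 0 < m := by
    have := (Complex.le_def.mp hT1).1
    rw [Complex.zero_re] at this
    positivity
  have hN : 0 < ((Fintype.card (Fin N → Fin N) : ℝ) * (N * m) ^ N) := by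
    rcases Nat.eq_zero_or_pos N with rfl | hN
    · simp
    · have : 0 < Fintype.card (Fin N → Fin N) := by
        have : Nonempty (Fin N) := ⟨⟨0, hN⟩⟩
        exact Fintype.card_pos
      positivity
  refine ⟨F U₀ / ((Fintype.card (Fin N → Fin N) : ℝ) * (N * m) ^ N), by positivity,
    fun X hX => ?_⟩
  obtain ⟨U, l, hU, hl, hl0, hXU⟩ := exists_antitone_diagonalization hX
  have hdetX : X.det.re = ∏ k, l k := by
    rw [hXU, Matrix.det_mul_comm, ← mul_assoc, mul_eq_one_comm.mp hU, one_mul,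
      Matrix.det_diagonal, ← Complex.ofReal_prod, Complex.ofReal_re]
  -- The eigenvalues decrease, so those with index at most k are at least l k.
  have hflag : ∀ k, (X - (l k : ℂ) • flagProj U k).PosSemidef := by
    intro k
    have : X - (l k : ℂ) • flagProj U k
        = U * Matrix.diagonal (fun i => (l i : ℂ) - l k * if i ≤ k then 1 else 0) * Uᴴ := by
      rw [show (Matrix.diagonal (fun i => (l i : ℂ) - l k * if i ≤ k then 1 else 0) : Mat N)
        = Matrix.diagonal (fun i => (l i : ℂ))
          - (l k : ℂ) • Matrix.diagonal (fun i => if i ≤ k then 1 else 0) by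
          rw [← Matrix.diagonal_smul, Matrix.diagonal_sub]; rfl,
        mul_sub, sub_mul, ← hXU, Matrix.mul_smul, Matrix.smul_mul, flagProj]
    rw [this]
    refine Matrix.PosSemidef.mul_mul_conjTranspose_same (Matrix.PosSemidef.diagonal fun i => ?_) U
    by_cases hik : i ≤ k
    · simpa [hik] using hl hik
    · simpa [hik] using (hl0 i).le
  have hmain : ∀ σ, (∏ k, l k) * Complex.normSq (V σ U).det ≤ (N * m) ^ N * (T X).det.re := by
    intro σ
    refine prod_mul_normSq_det_le hmpos.le (fun k => (hl0 k).le)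
      (fun k => hT _ (flagProj_posSemidef U k)) (fun k => ?_) (fun k => ?_) σ
    · have h1 := (hT.map_le (one_sub_flagProj_posSemidef hU k)).trace_nonneg
      rw [Matrix.trace_sub, sub_nonneg] at h1
      refine h1.trans ?_
      rw [hm, Complex.le_def] at *
      simpa using hT1.2.symm
    · have h1 := hT.map_le (hflag k)
      rwa [map_smul] at h1
  have hsum := Finset.sum_le_sum fun σ (_ : σ ∈ Finset.univ) => hmain σ
  rw [← Finset.mul_sum, Finset.sum_const, Finset.card_univ, nsmul_eq_mul] at hsum
  have hFU : F U₀ ≤ F U := hmin hU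
  have hprod : 0 ≤ ∏ k, l k := Finset.prod_nonneg fun k _ => (hl0 k).le
  rw [hdetX, div_mul_eq_mul_div, div_le_iff₀ hN]
  calc F U₀ * ∏ k, l k ≤ F U * ∏ k, l k := mul_le_mul_of_nonneg_right hFU hprod
    _ ≤ _ := by
      rw [mul_comm]
      refine hsum.trans_eq ?_
      ring

end Capacity

/-! ### Convergence of the Sinkhorn iteration. -/

section Convergence

/-- A quantitative form of the inequality of arithmetic and geometric means. -/
theorem trace_sub_one_sq_le {A : Mat N} (hA : A.PosDef) (htr : A.trace = N) :
    A.det.re ≤ 1 ∧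
      ((A - 1) ^ 2).trace.re ≤ (Real.sqrt N + 1) ^ 2 * -Real.log A.det.re := by
  obtain ⟨U, hU, hU', hAU⟩ := exists_eq_mul_diagonal_mul hA.1
  have hl : ∀ i, 0 < hA.1.eigenvalues i := hA.eigenvalues_pos
  generalize hA.1.eigenvalues = l at hAU hl
  have hdet : A.det.re = ∏ i, l i := by
    rw [hAU, Matrix.det_mul_comm, ← mul_assoc, hU, one_mul, Matrix.det_diagonal,
      ← Complex.ofReal_prod, Complex.ofReal_re]
  have hsum : ∑ i, l i = N := by
    rw [hAU, Matrix.trace_mul_comm, ← mul_assoc, hU, one_mul, Matrix.trace_diagonal] at htr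
    exact_mod_cast htr
  have hsq : ((A - 1) ^ 2).trace.re = ∑ i, (l i - 1) ^ 2 := by
    have h : A - 1 = U * Matrix.diagonal (fun i => (l i : ℂ) - 1) * Uᴴ := by
      rw [show (Matrix.diagonal (fun i => (l i : ℂ) - 1) : Mat N)
        = Matrix.diagonal (fun i => (l i : ℂ)) - 1 by
          rw [← Matrix.diagonal_one, Matrix.diagonal_sub], mul_sub, sub_mul, ← hAU, mul_one, hU']
    have h2 : (A - 1) ^ 2
        = U * Matrix.diagonal (fun i => ((l i : ℂ) - 1) * ((l i : ℂ) - 1)) * Uᴴ := by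
      rw [← Matrix.diagonal_mul_diagonal, h, pow_two]
      calc _ = U * Matrix.diagonal (fun i => (l i : ℂ) - 1) * (Uᴴ * U)
            * Matrix.diagonal (fun i => (l i : ℂ) - 1) * Uᴴ := by simp only [mul_assoc]
        _ = _ := by rw [hU, mul_one, mul_assoc U]
    rw [h2, Matrix.trace_mul_comm, ← mul_assoc, hU, one_mul, Matrix.trace_diagonal, Complex.re_sum]
    refine Finset.sum_congr rfl fun i _ => ?_
    rw [← Complex.ofReal_one, ← Complex.ofReal_sub, ← Complex.ofReal_mul, Complex.ofReal_re,
      pow_two]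
  have hK : (0 : ℝ) < (Real.sqrt N + 1) ^ 2 := by positivity
  -- With s = √l: log l = 2 log s ≤ 2(s - 1) gives l - 1 - log l ≥ (s - 1)², while (l - 1)² = (s +
  -- 1)²(s - 1)² and s ≤ √N by the trace condition. On summing, the terms l - 1 cancel.
  have key : ∀ i, (l i - 1) ^ 2 ≤ (Real.sqrt N + 1) ^ 2 * (l i - 1 - Real.log (l i)) := by
    intro i
    have hle : l i ≤ N := hsum ▸ Finset.single_le_sum (fun j _ => (hl j).le) (Finset.mem_univ i)
    set s := Real.sqrt (l i) with hs
    have hs0 : 0 < s := Real.sqrt_pos.mpr (hl i)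
    have hsl : l i = s ^ 2 := (Real.sq_sqrt (hl i).le).symm
    have hsN : s ≤ Real.sqrt N := Real.sqrt_le_sqrt hle
    have hlog : Real.log (l i) ≤ 2 * (s - 1) := by
      rw [hsl, Real.log_pow]
      have := Real.log_le_sub_one_of_pos hs0
      push_cast
      linarith
    have h1 : (s - 1) ^ 2 ≤ l i - 1 - Real.log (l i) := by
      have : (s - 1) ^ 2 = s ^ 2 - 1 - 2 * (s - 1) := by ring
      rw [this, ← hsl]
      linarith
    calc (l i - 1) ^ 2 = (s + 1) ^ 2 * (s - 1) ^ 2 := by rw [hsl]; ring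
      _ ≤ (Real.sqrt N + 1) ^ 2 * (l i - 1 - Real.log (l i)) := by gcongr
  have hfin : ∑ i, (l i - 1) ^ 2 ≤ (Real.sqrt N + 1) ^ 2 * -Real.log A.det.re := by
    refine (Finset.sum_le_sum fun i _ => key i).trans_eq ?_
    rw [← Finset.mul_sum, hdet, Real.log_prod fun i _ => (hl i).ne']
    simp [Finset.sum_sub_distrib, hsum]
  refine ⟨?_, hsq ▸ hfin⟩
  have h0 : 0 ≤ -Real.log A.det.re :=
    nonneg_of_mul_nonneg_right ((Finset.sum_nonneg fun i _ => sq_nonneg _).trans hfin) hK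
  have hpos : 0 < A.det.re := hdet ▸ Finset.prod_pos fun i _ => hl i
  exact (Real.log_nonpos_iff hpos.le).mp (by linarith)

theorem ofReal_det_re {A : Mat N} (hA : A.PosSemidef) : (A.det.re : ℂ) = A.det :=
  Complex.ext rfl (by simpa using (Complex.le_def.mp hA.det_nonneg).2)

theorem Scalable.posDef {T : Op N} (hT : IsPositive T) (h : Scalable T) :
    (T 1).PosDef ∧ (dual T 1).PosDef :=
  ⟨(hT 1 Matrix.PosSemidef.one).posDef_iff_isUnit.mpr h.1,
    (hT.dual 1 Matrix.PosSemidef.one).posDef_iff_isUnit.mpr h.2⟩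

theorem rowScaling_one {T : Op N} (h : (T 1).PosDef) : rowScaling T 1 = 1 := by
  rw [rowScaling, scaling_apply, invSqrt_isHermitian.eq]
  simpa using (invSqrt_mul_mul_invSqrt h).1

theorem dual_colScaling_one {T : Op N} (h : (dual T 1).PosDef) : dual (colScaling T) 1 = 1 := by
  rw [colScaling, dual_scaling_apply, invSqrt_isHermitian.eq]
  simpa using (invSqrt_mul_mul_invSqrt h).1

theorem HasCapacityGE.rowScaling {T : Op N} {c : ℝ} (hc : HasCapacityGE c T)
    (h : (T 1).PosDef) : HasCapacityGE (c / (T 1).det.re) (rowScaling T) := by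
  intro X hX
  have hdet : (OpScaling.rowScaling T X).det = ((T 1).det.re : ℂ)⁻¹ * (T X).det := by
    rw [OpScaling.rowScaling, scaling_apply, invSqrt_isHermitian.eq, ofReal_det_re h.posSemidef,
      ← det_invSqrt h]
    simp only [Matrix.det_mul, Matrix.conjTranspose_one, one_mul, mul_one]
    ring
  have hd : 0 < (T 1).det.re := (Complex.lt_def.mp h.det_pos).1
  rw [hdet, ← Complex.ofReal_inv, Complex.re_ofReal_mul, div_mul_eq_mul_div, inv_mul_eq_div]
  exact div_le_div_of_nonneg_right (hc X hX) hd.le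

/-- The substitution X ↦ SXS with S = T*(I)^(-1/2) preserves positive definiteness and divides det X
by det T*(I). -/
theorem HasCapacityGE.colScaling {T : Op N} {c : ℝ} (hc : HasCapacityGE c T)
    (h : (dual T 1).PosDef) : HasCapacityGE (c / (dual T 1).det.re) (colScaling T) := by
  intro X hX
  obtain ⟨-, hu⟩ := invSqrt_mul_mul_invSqrt h
  set S := invSqrt (dual T 1) with hS
  have hX' : (Sᴴ * X * S).PosDef :=
    hX.conjTranspose_mul_mul_same (Matrix.mulVec_injective_iff_isUnit.mpr hu)
  have hdet : (Sᴴ * X * S).det = ((dual T 1).det.re : ℂ)⁻¹ * X.det := by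
    rw [invSqrt_isHermitian.eq, ofReal_det_re h.posSemidef, ← det_invSqrt h]
    simp only [Matrix.det_mul]
    ring
  have h1 := hc _ hX'
  rw [hdet, ← Complex.ofReal_inv, Complex.re_ofReal_mul] at h1
  rw [OpScaling.colScaling, scaling_apply, one_mul, Matrix.conjTranspose_one, mul_one, ← hS,
    div_eq_mul_inv, mul_assoc]
  exact h1

theorem sinkhorn_succ_even {T : Op N} {n : ℕ} (hn : Even n) :
    sinkhorn T (n + 1) = rowScaling (sinkhorn T n) := if_pos hn

theorem sinkhorn_succ_odd {T : Op N} {n : ℕ} (hn : ¬ Even n) :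
    sinkhorn T (n + 1) = colScaling (sinkhorn T n) := if_neg hn

theorem sinkhorn_isPositive {T : Op N} (hT : IsPositive T) (n : ℕ) :
    IsPositive (sinkhorn T n) := by
  induction n with
  | zero => exact hT
  | succ n ih =>
    by_cases hn : Even n
    · rw [sinkhorn_succ_even hn]; exact ih.scaling _ _
    · rw [sinkhorn_succ_odd hn]; exact ih.scaling _ _

theorem sinkhorn_scalable {T : Op N} (hT : IsPositive T) (h : Scalable T) (n : ℕ) :
    Scalable (sinkhorn T n) := by
  induction n with
  | zero => exact h
  | succ n ih =>
    have hp := sinkhorn_isPositive hT n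
    obtain ⟨h1, h2⟩ := ih.posDef hp
    by_cases hn : Even n
    · rw [sinkhorn_succ_even hn]
      exact ih.scaling hp (invSqrt_mul_mul_invSqrt h1).2 isUnit_one
    · rw [sinkhorn_succ_odd hn]
      exact ih.scaling hp isUnit_one (invSqrt_mul_mul_invSqrt h2).2

theorem sinkhorn_eq_scaling (T : Op N) (n : ℕ) :
    ∃ C₁ C₂ : Mat N, sinkhorn T n = scaling C₁ C₂ T := by
  induction n with
  | zero => exact ⟨1, 1, by ext1 X; simp [scaling_apply, sinkhorn]⟩
  | succ n ih =>
    obtain ⟨C₁, C₂, h⟩ := ih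
    by_cases hn : Even n
    · rw [sinkhorn_succ_even hn, rowScaling]
      conv => enter [1, C₁, 1, C₂, 1, 3]; rw [h]
      exact ⟨_, _, scaling_scaling _ _ _ _ _⟩
    · rw [sinkhorn_succ_odd hn, colScaling]
      conv => enter [1, C₁, 1, C₂, 1, 3]; rw [h]
      exact ⟨_, _, scaling_scaling _ _ _ _ _⟩

/-- The determinant by which the `n`-th step of the iteration normalizes. -/
noncomputable def stepDet (T : Op N) (n : ℕ) : ℝ :=
  if Even n then (sinkhorn T n 1).det.re else (dual (sinkhorn T n) 1).det.re

theorem stepDet_pos {T : Op N} (hT : IsPositive T) (h : Scalable T) (n : ℕ) :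
    0 < stepDet T n := by
  obtain ⟨h1, h2⟩ := (sinkhorn_scalable hT h n).posDef (sinkhorn_isPositive hT n)
  rw [stepDet]
  split_ifs
  · exact (Complex.lt_def.mp h1.det_pos).1
  · exact (Complex.lt_def.mp h2.det_pos).1

theorem sinkhorn_hasCapacityGE {T : Op N} (hT : IsPositive T) (h : Scalable T) {c : ℝ}
    (hc : HasCapacityGE c T) (n : ℕ) :
    HasCapacityGE (c / ∏ i ∈ Finset.range n, stepDet T i) (sinkhorn T n) := by
  induction n with
  | zero => simpa [sinkhorn] using hc
  | succ n ih =>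
    obtain ⟨h1, h2⟩ := (sinkhorn_scalable hT h n).posDef (sinkhorn_isPositive hT n)
    rw [Finset.prod_range_succ, ← div_div, stepDet]
    by_cases hn : Even n
    · rw [if_pos hn, sinkhorn_succ_even hn]
      exact ih.rowScaling h1
    · rw [if_neg hn, sinkhorn_succ_odd hn]
      exact ih.colScaling h2

/-- The step just made turns one marginal into I. Since tr T(I) = tr T*(I), the other, which is the
next to be normalized, has trace N. The index starts at n + 1 because the initial operator is not
normalized. -/
theorem sinkhorn_succ_bounds {T : Op N} (hT : IsPositive T) (h : Scalable T) (n : ℕ) :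
    stepDet T (n + 1) ≤ 1 ∧ (sinkhorn T (n + 1) 1).det.re ≤ 1 ∧
      DS (sinkhorn T (n + 1)) ≤ (Real.sqrt N + 1) ^ 2 * -Real.log (stepDet T (n + 1)) := by
  obtain ⟨h1, h2⟩ := (sinkhorn_scalable hT h n).posDef (sinkhorn_isPositive hT n)
  have hp := sinkhorn_isPositive hT (n + 1)
  obtain ⟨h3, h4⟩ := (sinkhorn_scalable hT h (n + 1)).posDef hp
  have htr : (dual (sinkhorn T (n + 1)) 1).trace = (sinkhorn T (n + 1) 1).trace := by
    simpa using trace_mul_dual_one _ hp 1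
  by_cases hn : Even n
  · have hone : sinkhorn T (n + 1) 1 = 1 := by rw [sinkhorn_succ_even hn, rowScaling_one h1]
    have hodd : ¬ Even (n + 1) := by simpa [Nat.even_add_one] using hn
    rw [hone, Matrix.trace_one, Fintype.card_fin] at htr
    obtain ⟨b1, b2⟩ := trace_sub_one_sq_le h4 htr
    rw [stepDet, if_neg hodd, DS, hone]
    refine ⟨b1, by simp, ?_⟩
    simpa using b2
  · have hone : dual (sinkhorn T (n + 1)) 1 = 1 := by
      rw [sinkhorn_succ_odd hn, dual_colScaling_one h2]
    have heven : Even (n + 1) := Nat.even_add_one.mpr hn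
    rw [hone, Matrix.trace_one, Fintype.card_fin] at htr
    obtain ⟨b1, b2⟩ := trace_sub_one_sq_le h3 htr.symm
    rw [stepDet, if_pos heven, DS, hone]
    refine ⟨b1, b1, ?_⟩
    simpa using b2

theorem DS_nonneg {T : Op N} (hT : IsPositive T) : 0 ≤ DS T := by
  have h : ∀ M : Mat N, M.PosSemidef → 0 ≤ ((M - 1) ^ 2).trace.re := fun M hM => by
    have hH : (M - 1).IsHermitian := hM.1.sub Matrix.isHermitian_one
    have := (Matrix.posSemidef_conjTranspose_mul_self (M - 1)).trace_nonneg
    rw [hH.eq, ← pow_two] at this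
    exact (Complex.le_def.mp this).1
  exact add_nonneg (h _ (hT 1 Matrix.PosSemidef.one)) (h _ (hT.dual 1 Matrix.PosSemidef.one))

/-- Operator Sinkhorn scaling of a rank non-decreasing operator converges. -/
theorem RankNonDecreasing.tendsto_DS_sinkhorn {T : Op N} (hT : IsPositive T)
    (h : RankNonDecreasing T) : Tendsto (fun n => DS (sinkhorn T n)) atTop (𝓝 0) := by
  obtain ⟨c, hc0, hc⟩ := h.exists_hasCapacityGE hT
  have hS := h.scalable hT
  have hpos := stepDet_pos hT hS
  set a : ℕ → ℝ := fun n => -Real.log (stepDet T n) with ha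
  have hbound : ∀ n, ∑ i ∈ Finset.range n, a (i + 1) ≤ -Real.log c - a 0 := by
    intro n
    have hP : 0 < ∏ i ∈ Finset.range (n + 1), stepDet T i := Finset.prod_pos fun i _ => hpos i
    -- At X = I the capacity bound reads c / ∏ `stepDet` ≤ det T_{n+1}(I) ≤ 1, so the product never
    -- drops below c.
    have h1 := sinkhorn_hasCapacityGE hT hS hc (n + 1) 1 Matrix.PosDef.one
    rw [Matrix.det_one, Complex.one_re, mul_one] at h1
    have h2 := (div_le_one hP).mp (h1.trans (sinkhorn_succ_bounds hT hS n).2.1)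
    have h3 := Real.log_le_log hc0 h2
    rw [Real.log_prod fun i _ => (hpos i).ne'] at h3
    have h4 := Finset.sum_range_succ' a n
    rw [ha, Finset.sum_neg_distrib] at h4
    rw [ha]
    linarith
  have hsummable : Summable fun n => a (n + 1) :=
    summable_of_sum_range_le
      (fun n => neg_nonneg.mpr
        (Real.log_nonpos (hpos _).le (sinkhorn_succ_bounds hT hS n).1)) hbound
  rw [← tendsto_add_atTop_iff_nat 1]
  refine squeeze_zero (fun n => DS_nonneg (sinkhorn_isPositive hT _))
    (fun n => (sinkhorn_succ_bounds hT hS n).2.2) ?_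
  have hlim := hsummable.tendsto_atTop_zero.const_mul ((Real.sqrt N + 1) ^ 2)
  rwa [mul_zero] at hlim

/-- 1/N² < 2/N, so the rank criterion applies to the scaled operator and is then carried back to T.
-/
theorem rankNonDecreasing_of_isEpsDoublyStochastic (hN : 0 < N) {T : Op N} (hT : IsPositive T)
    {C₁ C₂ : Mat N} (h : IsEpsDoublyStochastic (1 / (N : ℝ)) (scaling C₁ C₂ T)) :
    RankNonDecreasing T := by
  have hp := hT.scaling C₁ C₂
  have hlt : DS (scaling C₁ C₂ T) < 2 / N := by
    refine lt_of_le_of_lt h ?_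
    have h1 : (1 : ℝ) ≤ N := by exact_mod_cast hN
    rw [div_pow, one_pow, div_lt_div_iff₀ (by positivity) (by positivity)]
    nlinarith
  have hr := rankNonDecreasing_of_DS_lt hp hlt
  exact rankNonDecreasing_of_scaling hr (hr.scalable hp)

end Convergence

end OpScaling

/-! ### The equivalences assembled. -/

theorem theorem4p6 (N : ℕ) (hN : 0 < N) (T : OpScaling.Op N) (hT : OpScaling.IsPositive T) :
    -- the trajectory is defined as soon as `T(I)` and `T*(I)` are nonsingular
    ((OpScaling.Scalable T → ∀ n : ℕ, OpScaling.Scalable (OpScaling.sinkhorn T n)) ∧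
      -- which is the case for every rank non-decreasing `T`
      (OpScaling.RankNonDecreasing T → OpScaling.Scalable T) ∧
      (OpScaling.Scalable T →
        (Tendsto (fun n : ℕ => OpScaling.DS (OpScaling.sinkhorn T n)) atTop (𝓝 0) ↔
          OpScaling.RankNonDecreasing T))) ∧
    (OpScaling.RankNonDecreasing T ↔
      ∀ ε : ℝ, 0 < ε → ∃ C₁ C₂ : OpScaling.Mat N,
        OpScaling.IsEpsDoublyStochastic ε (OpScaling.scaling C₁ C₂ T)) ∧
    (OpScaling.RankNonDecreasing T ↔
      ∃ C₁ C₂ : OpScaling.Mat N,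
        OpScaling.IsEpsDoublyStochastic (1 / (N : ℝ)) (OpScaling.scaling C₁ C₂ T)) := by
  have hN' : (0 : ℝ) < 1 / N := by positivity
  have approx : Tendsto (fun n : ℕ => OpScaling.DS (OpScaling.sinkhorn T n)) atTop (𝓝 0) →
      ∀ ε : ℝ, 0 < ε → ∃ C₁ C₂ : OpScaling.Mat N,
        OpScaling.IsEpsDoublyStochastic ε (OpScaling.scaling C₁ C₂ T) := by
    intro h ε hε
    obtain ⟨n, hn⟩ := (h.eventually_le_const (pow_pos hε 2)).exists
    obtain ⟨C₁, C₂, hC⟩ := OpScaling.sinkhorn_eq_scaling T n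
    exact ⟨C₁, C₂, hC ▸ hn⟩
  have back : (∃ C₁ C₂ : OpScaling.Mat N,
      OpScaling.IsEpsDoublyStochastic (1 / (N : ℝ)) (OpScaling.scaling C₁ C₂ T)) →
      OpScaling.RankNonDecreasing T := fun ⟨_, _, h⟩ =>
    OpScaling.rankNonDecreasing_of_isEpsDoublyStochastic hN hT h
  refine ⟨⟨OpScaling.sinkhorn_scalable hT, fun h => h.scalable hT,
    fun _ => ⟨fun h => ?_, fun h => ?_⟩⟩,
    ⟨fun h => ?_, fun h => ?_⟩, ⟨fun h => ?_, back⟩⟩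
  · exact back (approx h _ hN')
  · exact h.tendsto_DS_sinkhorn hT
  · exact approx (h.tendsto_DS_sinkhorn hT)
  · exact back (h _ hN')
  · exact approx (h.tendsto_DS_sinkhorn hT) _ hN'
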